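/- Let $M$ be a binary matroid on a finite ground set $E(M)$, i.e. a matroid isomorphic to the vector matroid of a matrix over $\mathbb F_2$, and let $\mathbb K$ be a field. *Cycle ideal.* A cycle of $M$ is a (possibly empty) disjoint union of circuits of $M$; let $\mathrm{Cyc}(M)$ be the set of cycles. The cycle ideal $I_{\mathrm{Cyc}(M)}$ is the kernel of the $\mathbb K$-algebra homomorphism $$\mathbb K[x_C : C\in \mathrm{Cyc}(M)]\to \mathbb K[y_e, z : e\in E(M)],\qquad x_C\mapsto z\prod_{e\in C}y_e .$$ With $\deg x_C=1$ this is a homogeneous ideal, and $\mu(M)$ denotes the highest degree of an element of a minimal homogeneous generating set of it ($\mu(M)=-\infty$ if the ideal is zero). *Operations.* A deletion of $M$ is $M\setminus e$ with $e\in E(M)$; a series contraction is $M/e$ with $e$ contained in a two-element cocircuit of $M$; a coloop contraction is $M/e$ with $e$ a coloop of $M$. Let $E=\{e_1,\dots,e_s\}$ and $E'=\{e'_1,\dots,e'_s\}$ be disjoint subsets of $E(M)$ with $s\ge 1$ elements each. Suppose that $E'$ is a circuit of $M$ and that for every circuit $C$ of $M$ and every proper subset $J\subsetneq\{1,\dots,s\}$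 (with $E_J=\{e_j: j\in J\}$, $E'_J=\{e'_j: j\in J\}$): * if $C\cap E'=E'_J$, then $C\cap E=E_J$ or $C\cap E=E\setminus E_J$; * if $C\cap E=E_J$, then $C\cap E'=E'_J$ or $C\cap E'=E'\setminus E'_J$. Then $M/E'$ is called a binary matroidal retract of the binary matroid $M$. A g-series minor of $M$ is a matroid obtained from $M$ by a (possibly empty) finite sequence of deletions, series contractions, coloop contractions and binary matroidal retracts. Let $M(K_4)$ be the cycle matroid of the complete graph on four vertices. Consider the statements: * (a) $\mu(M)\le 2$. * (a$'$) $M$ has no minor isomorphic to $M(K_4)$. * (b) $M$ has no g-series minor isomorphic to $M(K_4)$. * (c) No matroid isomorphic to $M(K_4)$ can be obtained from $M$ by a finite sequence of deletions, series contractions and coloop contractions. Then (a) implies (b), (a$'$) implies (b), and (b) implies (c). -/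

import Mathlib

open scoped Matroid

noncomputable section

/-! ### Cycle matroids of graphs -/

namespace SimpleGraph

/-- Augmentation property of the edge sets of forests. -/
theorem exists_acyclic_insert {V : Type*} [Finite V] (I J : Set (Sym2 V))
    (hJd : ∀ e ∈ J, ¬ e.IsDiag)
    (hI : (fromEdgeSet I).IsAcyclic) (hJ : (fromEdgeSet J).IsAcyclic)
    (hIJ : I.ncard < J.ncard) :
    ∃ e ∈ J, e ∉ I ∧ (fromEdgeSet (insert e I)).IsAcyclic := by
  classical
  by_contra! hcon
  have hne : J.Nonempty := by
    rw [← Set.ncard_pos]; omega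
  obtain ⟨e₀, -⟩ := hne
  have hV : Nonempty V := e₀.ind (fun a _ => ⟨a⟩)
  have hreach : ∀ u v, s(u, v) ∈ J → (fromEdgeSet I).Reachable u v := by
    intro u v huv
    by_cases hmem : s(u, v) ∈ I
    · have hne : u ≠ v := fun h => hJd _ huv (by simpa using h)
      exact Adj.reachable (by simpa using ⟨hmem, hne⟩)
    · by_contra hr
      refine hcon _ huv hmem ?_
      have := (isAcyclic_add_edge_iff_of_not_reachable u v hr).2 hI
      have heq : fromEdgeSet (insert s(u, v) I) = fromEdgeSet I ⊔ fromEdgeSet {s(u, v)} := by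
        rw [← fromEdgeSet_union, Set.union_comm, Set.singleton_union]
      rw [heq]
      simpa [edge] using this
  obtain ⟨T, hJT, -, hT⟩ :=
    (connected_top : (⊤ : SimpleGraph V).Connected).exists_isTree_le_of_le_of_isAcyclic
      le_top hJ
  have hJT' : J ⊆ T.edgeSet := by
    intro e he
    have h1 : e ∈ (fromEdgeSet J).edgeSet := by
      rw [edgeSet_fromEdgeSet]; exact ⟨he, hJd e he⟩
    exact edgeSet_mono hJT h1
  set S : Set (Sym2 V) := (T.edgeSet \ J) ∪ I with hS
  have hconn : (fromEdgeSet S).Connected := by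
    have hadj : ∀ u v, T.Adj u v → (fromEdgeSet S).Reachable u v := by
      intro u v huv
      by_cases hmem : s(u, v) ∈ J
      · exact (hreach u v hmem).mono (fromEdgeSet_mono Set.subset_union_right)
      · exact Adj.reachable (by
          rw [fromEdgeSet_adj]
          exact ⟨Or.inl ⟨huv, hmem⟩, huv.ne⟩)
    refine ⟨fun u v => ?_⟩
    obtain ⟨w⟩ := hT.connected.preconnected u v
    induction w with
    | nil => exact Reachable.refl _
    | cons h _ ih => exact (hadj _ _ h).trans ih
  have h1 := hconn.card_vert_le_card_edgeSet_add_one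
  have h2 := (isTree_iff_connected_and_card.1 hT).2
  have h3 : (fromEdgeSet S).edgeSet.ncard ≤ S.ncard :=
    Set.ncard_le_ncard (by rw [edgeSet_fromEdgeSet]; exact Set.sdiff_subset) (Set.toFinite _)
  have h4 : S.ncard ≤ (T.edgeSet \ J).ncard + I.ncard := Set.ncard_union_le _ _
  have h5 := Set.ncard_sdiff_add_ncard_of_subset hJT' (Set.toFinite _)
  rw [Nat.card_coe_set_eq] at h1 h2
  omega

/-- The cycle matroid `M(G)` of a finite simple graph `G`: its ground set is the edge set of `G`
and a set of edges is independent iff it contains no cycle. -/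
def cycleMatroid {V : Type*} [Finite V] (G : SimpleGraph V) : Matroid (Sym2 V) :=
  (IndepMatroid.ofFinite (E := G.edgeSet) (Set.toFinite _)
    (fun I => I ⊆ G.edgeSet ∧ (fromEdgeSet I).IsAcyclic)
    ⟨Set.empty_subset _, by rw [fromEdgeSet_empty]; exact isAcyclic_bot⟩
    (fun _ _ hJ hIJ => ⟨hIJ.trans hJ.1, hJ.2.anti (fromEdgeSet_mono hIJ)⟩)
    (fun I J hI hJ hIJ => by
      obtain ⟨e, he, heI, hac⟩ := exists_acyclic_insert I J
        (fun e he => G.not_isDiag_of_mem_edgeSet (hJ.1 he)) hI.2 hJ.2 hIJ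
      exact ⟨e, he, heI, Set.insert_subset (hJ.1 he) hI.1, hac⟩)
    (fun _ hI => hI.1)).matroid

end SimpleGraph

namespace Matroid

/-- `M(K₄)`, the cycle matroid of the complete graph on four vertices. -/
def MK4 : Matroid (Sym2 (Fin 4)) := (⊤ : SimpleGraph (Fin 4)).cycleMatroid

/-! ### Isomorphism and binary matroids -/

/-- `M` and `N` are isomorphic: some bijection of the ground sets carries `M` to `N`. -/
def IsIsomorphic {α β : Type*} (M : Matroid α) (N : Matroid β) : Prop :=
  ∃ φ : M.E ≃ N.E, M.mapSetEquiv φ = N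

/-- `M` is binary: it is (up to labelling the columns by the ground set) the vector matroid of a
matrix over the field with two elements. -/
def IsBinary {α : Type*} (M : Matroid α) : Prop :=
  ∃ (m : ℕ) (A : Matrix (Fin m) M.E (ZMod 2)),
    ∀ I : Set M.E, M.Indep (Subtype.val '' I) ↔ LinearIndepOn (ZMod 2) A.col I

/-! ### Cycles, the cycle ideal and `μ` -/

/-- A cycle of `M` is a disjoint union of circuits of `M`. -/
def IsCycle {α : Type*} (M : Matroid α) (C : Set α) : Prop :=
  ∃ S : Set (Set α), (∀ D ∈ S, M.IsCircuit D) ∧ S.PairwiseDisjoint id ∧ ⋃₀ S = C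

/-- `Cyc(M)`, the set of cycles of `M`. -/
abbrev Cyc {α : Type*} (M : Matroid α) : Type _ := {C : Set α // M.IsCycle C}

/-- The homomorphism `𝕜[x_C : C ∈ Cyc(M)] → 𝕜[y_e, z : e ∈ E(M)]`, `x_C ↦ (∏_{e ∈ C} y_e) z`,
whose image is the cycle algebra of `M`. The variable `y_e` is `X (some e)`, and `z` is
`X none`. -/
def cycleHom (𝕜 : Type*) [Field 𝕜] {α : Type*} (M : Matroid α) :
    MvPolynomial M.Cyc 𝕜 →ₐ[𝕜] MvPolynomial (Option M.E) 𝕜 :=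
  MvPolynomial.aeval fun C =>
    (∏ᶠ (e : M.E) (_ : (e : α) ∈ (C : Set α)), MvPolynomial.X (some e)) * MvPolynomial.X none

/-- The cycle ideal of `M` over `𝕜`. -/
def cycleIdeal (𝕜 : Type*) [Field 𝕜] {α : Type*} (M : Matroid α) :
    Ideal (MvPolynomial M.Cyc 𝕜) :=
  RingHom.ker (M.cycleHom 𝕜)

/-- `G` is a minimal homogeneous generating set of the ideal `I`. -/
def IsMinHomogGenSet {σ 𝕜 : Type*} [Field 𝕜] (I : Ideal (MvPolynomial σ 𝕜))
    (G : Set (MvPolynomial σ 𝕜)) : Prop :=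
  Minimal (fun G => (∀ f ∈ G, ∃ n, f.IsHomogeneous n) ∧ Ideal.span G = I) G

/-- `μ(M)`, the highest degree of an element of a minimal homogeneous generating set of the cycle
ideal (it does not depend on the minimal homogeneous generating set). It is `-∞ = ⊥` for the zero
ideal, whose only minimal generating set is `∅`. -/
def mu (𝕜 : Type*) [Field 𝕜] {α : Type*} (M : Matroid α) : WithBot ℕ∞ :=
  ⨆ (G : Set (MvPolynomial M.Cyc 𝕜)) (_ : IsMinHomogGenSet (M.cycleIdeal 𝕜) G) (f ∈ G),
    ((f.totalDegree : ℕ∞) : WithBot ℕ∞)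

/-! ### Minors -/

/-- `N` is obtained from `M` by one deletion, one series contraction or one coloop contraction. -/
inductive SeriesStep {α : Type*} (M : Matroid α) : Matroid α → Prop
  | deletion (e : α) (he : e ∈ M.E) : SeriesStep M (M ＼ {e})
  | seriesContraction (e : α) (K : Set α) (hK : M.IsCocircuit K) (hcard : K.ncard = 2)
      (he : e ∈ K) : SeriesStep M (M ／ {e})
  | coloopContraction (e : α) (he : M.IsColoop e) : SeriesStep M (M ／ {e})

/-- `N` is a binary matroidal retract of the binary matroid `M`: `N = M / E'`, where
`E = {e₁, …, eₛ}` and `E' = {e'₁, …, e'ₛ}` are disjoint subsets of the ground set with `s ≥ 1`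
elements each, `E'` is a circuit of `M` and, for every circuit `C` of `M` and every proper subset
`J` of the index set, if `C` meets one of `E`, `E'` exactly in the elements indexed by `J`, then it
meets the other one exactly in the elements indexed by `J` or by the complement of `J`. -/
def IsBinaryMatroidalRetract {α : Type*} (N M : Matroid α) : Prop :=
  M.IsBinary ∧ ∃ (s : ℕ) (e e' : Fin s → α), 1 ≤ s ∧ e.Injective ∧ e'.Injective ∧
    Disjoint (Set.range e) (Set.range e') ∧ Set.range e ⊆ M.E ∧
    M.IsCircuit (Set.range e') ∧
    (∀ C, M.IsCircuit C → ∀ J : Set (Fin s), J ≠ Set.univ →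
      (C ∩ Set.range e' = e' '' J →
        C ∩ Set.range e = e '' J ∨ C ∩ Set.range e = e '' Jᶜ) ∧
      (C ∩ Set.range e = e '' J →
        C ∩ Set.range e' = e' '' J ∨ C ∩ Set.range e' = e' '' Jᶜ)) ∧
    N = M ／ Set.range e'

/-- One step in the construction of a g-series minor. -/
inductive GSeriesStep {α : Type*} (M : Matroid α) : Matroid α → Prop
  | series (N : Matroid α) (h : M.SeriesStep N) : GSeriesStep M N
  | retract (N : Matroid α) (h : N.IsBinaryMatroidalRetract M) : GSeriesStep M N

/-- `N` is obtained from `M` by a sequence of deletions, series contractions and coloop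
contractions. -/
def IsSeriesColoopMinor {α : Type*} (N M : Matroid α) : Prop :=
  Relation.ReflTransGen SeriesStep M N

/-- `N` is a generalized series minor (g-series minor) of `M`: it is obtained from `M` by a
sequence of deletions, series contractions, coloop contractions and binary matroidal retracts. -/
def IsGSeriesMinor {α : Type*} (N M : Matroid α) : Prop :=
  Relation.ReflTransGen GSeriesStep M N

/-- `M` has no minor isomorphic to `H`. -/
def MinorFree {α β : Type*} (M : Matroid α) (H : Matroid β) : Prop :=
  ∀ N : Matroid α, N ≤m M → ¬ N.IsIsomorphic H

/-- `M` has no g-series minor isomorphic to `H`. -/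
def GSeriesMinorFree {α β : Type*} (M : Matroid α) (H : Matroid β) : Prop :=
  ∀ N : Matroid α, N.IsGSeriesMinor M → ¬ N.IsIsomorphic H

/-- `M` has no minor isomorphic to `H` that is obtained by deletions, series contractions or coloop
contractions. -/
def SeriesColoopMinorFree {α β : Type*} (M : Matroid α) (H : Matroid β) : Prop :=
  ∀ N : Matroid α, N.IsSeriesColoopMinor M → ¬ N.IsIsomorphic H

end Matroid

end

/-! The last two implications are formal: every operation is a deletion or a contraction, so a
g-series minor is a minor, and each operation allowed in (c) is among those allowed in (b). The
content is that (a) implies (b), and it rests on two facts about the property `IsQuadratic`, that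
the cycle ideal is generated in degree at most two: every operation preserves it, and `M(K₄)` lacks
it.

Preservation is an algebra retract argument (`IsGeneratedInDegreeLE.of_retract`). For an operation
from `M` to `N`, the polynomial ring on `Cyc(N)` is a retract of the one on `Cyc(M)` through
variables or zero, compatibly with the two monomial maps. A relation for `N` is lifted to `M`,
expanded in generators of degree at most two, and projected back. Deletion sends the cycles meeting
the deleted set to zero, and a coloop contraction is a deletion. For series contractions and
matroidal retracts (`IsQuadratic.of_lift`), each cycle of `N` has a distinguished lift to `M`, whose
contracted elements are determined by other elements of the cycle; for retracts this uses that
cycles of a binary matroid are closed under symmetric difference.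

For `M(K₄)`, the eight cycles satisfy the quartic relation "empty set times three quadrangles =
product of four triangles". By `cycExponent_MK4_injOn`, distinct monomials of equal degree at most
three have distinct images, so the ideal has no nonzero homogeneous element of degree at most two,
although it is not zero. -/

noncomputable section

/-! ### Ideals generated in bounded degree, and algebra retracts -/

namespace MvPolynomial

variable {σ τ 𝕜 : Type*} [Field 𝕜]

/-- The ideal `I` is generated by its homogeneous elements of degree at most `d`. -/
def IsGeneratedInDegreeLE (I : Ideal (MvPolynomial σ 𝕜)) (d : ℕ) : Prop :=
  I ≤ Ideal.span {f | f ∈ I ∧ ∃ n ≤ d, f.IsHomogeneous n}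

/-- Generation in bounded degree passes from the kernel of `φ` to the kernel of `ψ` when `ψ` is
a retract of `φ` through homomorphisms given by linear forms. -/
theorem IsGeneratedInDegreeLE.of_retract {A B : Type*} [CommRing A] [CommRing B] [Algebra 𝕜 A]
    [Algebra 𝕜 B] {φ : MvPolynomial σ 𝕜 →ₐ[𝕜] A} {ψ : MvPolynomial τ 𝕜 →ₐ[𝕜] B}
    (i : τ → σ) (r : σ → MvPolynomial τ 𝕜) (hr : ∀ s, (r s).IsHomogeneous 1)
    (hri : ∀ t, r (i t) = X t) (θ : B →ₐ[𝕜] A) (ρ : A →ₐ[𝕜] B)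
    (hθ : ∀ t, φ (X (i t)) = θ (ψ (X t))) (hρ : ∀ s, ψ (r s) = ρ (φ (X s))) {d : ℕ}
    (h : IsGeneratedInDegreeLE (RingHom.ker φ) d) :
    IsGeneratedInDegreeLE (RingHom.ker ψ) d := by
  have hρ' : ψ.comp (aeval r) = ρ.comp φ := by ext s; simp [hρ]
  have hθ' : φ.comp (rename i) = θ.comp ψ := by ext s; simp [hθ]
  have hid : (aeval r).comp (rename i) = AlgHom.id 𝕜 (MvPolynomial τ 𝕜) := by
    ext1 s; simp [hri]
  intro f hf
  have hf' : rename i f ∈ RingHom.ker φ := by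
    rw [RingHom.mem_ker] at hf ⊢
    have := DFunLike.congr_fun hθ' f
    simp only [AlgHom.comp_apply, hf, map_zero] at this
    exact this
  have hmem := Ideal.mem_map_of_mem (aeval r : MvPolynomial σ 𝕜 →ₐ[𝕜] MvPolynomial τ 𝕜) (h hf')
  -- Since `aeval r` retracts `rename i`, the image of the lifted relation is `f` itself. The
  -- generators map into the kernel of `ψ` without rise in degree, because `r` has linear values.
  rw [Ideal.map_span, ← AlgHom.comp_apply, hid] at hmem
  refine Ideal.span_mono ?_ hmem
  rintro _ ⟨g, ⟨hg, n, hn, hgn⟩, rfl⟩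
  refine ⟨?_, n, hn, by simpa using hgn.aeval r hr⟩
  rw [RingHom.mem_ker] at hg ⊢
  have := DFunLike.congr_fun hρ' g
  simp only [AlgHom.comp_apply, hg, map_zero] at this
  exact this

/-- A homomorphism sending each variable to a weighted homogeneous polynomial of weight `1`
commutes with taking homogeneous components. -/
theorem aeval_homogeneousComponent {w : τ → ℕ} (g : σ → MvPolynomial τ 𝕜)
    (hg : ∀ s, IsWeightedHomogeneous w (g s) 1) (n : ℕ) (f : MvPolynomial σ 𝕜) :
    aeval g (homogeneousComponent n f) = weightedHomogeneousComponent w n (aeval g f) := by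
  induction f using MvPolynomial.induction_on' with
  | add p q hp hq => rw [map_add, map_add, map_add, map_add, hp, hq]
  | monomial m a =>
    have hm : IsWeightedHomogeneous w (aeval g (monomial m a)) m.degree := by
      rw [aeval_monomial, algebraMap_eq]
      refine IsWeightedHomogeneous.C_mul ?_ a
      have := IsWeightedHomogeneous.prod m.support (fun s => g s ^ m s) (fun s => m s * 1)
        (w := w) fun s _ => by simpa using (hg s).pow (m s)
      simpa [Finsupp.prod, Finsupp.degree_apply] using this
    by_cases hn : m.degree = n
    · subst hn
      rw [hm.weightedHomogeneousComponent_same,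
        homogeneousComponent_of_mem (isHomogeneous_monomial a rfl), if_pos rfl]
    · rw [hm.weightedHomogeneousComponent_ne _ (Ne.symm hn),
        homogeneousComponent_of_mem (isHomogeneous_monomial a rfl), if_neg (Ne.symm hn), map_zero]

open Matroid in
/-- If the degrees of the elements of the minimal homogeneous generating sets of `I` are at most
`d`, then `I` is generated in degree at most `d`. -/
theorem IsGeneratedInDegreeLE.of_isMinHomogGenSet [Finite σ] {I : Ideal (MvPolynomial σ 𝕜)}
    (hI : ∀ f ∈ I, ∀ n, homogeneousComponent n f ∈ I) {d : ℕ}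
    (h : ∀ G, IsMinHomogGenSet I G → ∀ f ∈ G, f.totalDegree ≤ d) :
    IsGeneratedInDegreeLE I d := by
  -- The hypothesis is vacuous unless some minimal homogeneous generating set exists, so one is
  -- built: take the homogeneous components of finitely many generators and thin them out.
  obtain ⟨s, hs⟩ := IsNoetherian.noetherian I
  set T : Set (MvPolynomial σ 𝕜) :=
    ⋃ f ∈ s, (fun n => homogeneousComponent n f) '' Set.Iic f.totalDegree with hT
  have hTfin : T.Finite := s.finite_toSet.biUnion fun f _ => (Set.finite_Iic _).image _
  have hThom : ∀ f ∈ T, ∃ n, f.IsHomogeneous n := by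
    intro f hf
    simp only [hT, Set.mem_iUnion, Set.mem_image] at hf
    obtain ⟨p, -, n, -, rfl⟩ := hf
    exact ⟨n, homogeneousComponent_isHomogeneous n p⟩
  have hTspan : Ideal.span T = I := by
    apply le_antisymm
    · rw [Ideal.span_le]
      intro f hf
      simp only [hT, Set.mem_iUnion, Set.mem_image] at hf
      obtain ⟨p, hp, n, -, rfl⟩ := hf
      exact hI _ (hs ▸ Submodule.subset_span hp) n
    · rw [← hs, Submodule.span_le]
      intro p hp
      rw [SetLike.mem_coe, ← sum_homogeneousComponent p]
      refine Ideal.sum_mem _ fun n hn => Ideal.subset_span ?_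
      simp only [hT, Set.mem_iUnion]
      exact ⟨p, hp, n, by simpa [Nat.lt_succ_iff] using hn, rfl⟩
  obtain ⟨G, hGT, hG⟩ := Set.Finite.exists_le_minimal
    (s := {G | G ⊆ T ∧ Ideal.span G = I}) (hTfin.finite_subsets.subset fun G hG => hG.1)
    (show T ∈ _ from ⟨subset_rfl, hTspan⟩)
  have hGmin : IsMinHomogGenSet I G := by
    refine ⟨⟨fun f hf => hThom f (hGT hf), hG.prop.2⟩, fun G' hG' hle => ?_⟩
    -- Minimality among subsets of `T` suffices, since any competitor below `G` lies in `T` as well.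
    exact hG.2 ⟨hle.trans hGT, hG'.2⟩ hle
  intro p hp
  rw [← hG.prop.2] at hp
  refine Ideal.span_mono (show G ⊆ {f | f ∈ I ∧ ∃ n ≤ d, f.IsHomogeneous n} from fun f hf => ?_) hp
  refine ⟨hG.prop.2 ▸ Ideal.subset_span hf, ?_⟩
  obtain ⟨n, hn⟩ := hThom f (hGT hf)
  -- Zero is homogeneous of every degree, so for it `n` need not be the total degree.
  by_cases hf0 : f = 0
  · exact ⟨0, zero_le, hf0 ▸ isHomogeneous_zero _ _ _⟩
  · exact ⟨n, hn.totalDegree hf0 ▸ h G hGmin f hf, hn⟩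

end MvPolynomial

/-! ### The cycle ideal as a kernel in a common target ring -/

namespace Matroid

open MvPolynomial

variable {α β 𝕜 : Type*} [Field 𝕜]

/-- The monomial `z ∏_{e ∈ C} y_e`. -/
def setMonomial (𝕜 : Type*) [Field 𝕜] (C : Set α) : MvPolynomial (Option α) 𝕜 :=
  (∏ᶠ e ∈ C, X (some e)) * X none

/-- The homomorphism with `x_C ↦ z ∏_{e ∈ C} y_e`, with a variable `y_e` for every `e : α`. -/
def setHom (𝕜 : Type*) [Field 𝕜] (M : Matroid α) :
    MvPolynomial M.Cyc 𝕜 →ₐ[𝕜] MvPolynomial (Option α) 𝕜 :=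
  aeval fun C => setMonomial 𝕜 (C : Set α)

theorem IsCycle.subset_ground {M : Matroid α} {C : Set α} (hC : M.IsCycle C) : C ⊆ M.E := by
  obtain ⟨S, hS, -, rfl⟩ := hC
  exact Set.sUnion_subset fun D hD => (hS D hD).subset_ground

theorem IsCycle.finite {M : Matroid α} [M.Finite] {C : Set α} (hC : M.IsCycle C) : C.Finite :=
  M.ground_finite.subset hC.subset_ground

instance (M : Matroid α) [M.Finite] : Finite M.Cyc :=
  (M.ground_finite.finite_subsets.subset fun _ hC => IsCycle.subset_ground hC).to_subtype

/-- The two homomorphisms differ by an injective renaming of variables. With `setHom`, a matroid and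
its minors share one target ring. -/
theorem cycleIdeal_eq_ker_setHom (M : Matroid α) [M.Finite] :
    M.cycleIdeal 𝕜 = RingHom.ker (M.setHom 𝕜) := by
  have hinj : Function.Injective (Option.map (Subtype.val : M.E → α)) :=
    Option.map_injective Subtype.val_injective
  have h : M.setHom 𝕜 = (rename (Option.map (Subtype.val : M.E → α))).comp (M.cycleHom 𝕜) := by
    ext1 C
    simp only [setHom, cycleHom, aeval_X, AlgHom.comp_apply, map_mul, rename_X, Option.map_none,
      setMonomial]
    congr 1
    have hfin : {e : M.E | (e : α) ∈ (C : Set α)}.Finite := by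
      have := M.ground_finite.to_subtype
      exact Set.toFinite _
    have h1 : (rename (R := 𝕜) (Option.map (Subtype.val : M.E → α)))
        (∏ᶠ (e : M.E) (_ : (e : α) ∈ (C : Set α)), X (some e)) =
        ∏ᶠ e ∈ {e : M.E | (e : α) ∈ (C : Set α)}, X (some (e : α)) := by
      refine ((rename (R := 𝕜) (Option.map (Subtype.val : M.E → α)) :
        _ →ₐ[𝕜] _).toMonoidHom.map_finprod_mem _ hfin).trans ?_
      simp
    have himg : Subtype.val '' {e : M.E | (e : α) ∈ (C : Set α)} = (C : Set α) := by
      ext e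
      exact ⟨by rintro ⟨x, hx, rfl⟩; exact hx, fun he => ⟨⟨e, C.2.subset_ground he⟩, he, rfl⟩⟩
    rw [h1, ← finprod_mem_image (g := Subtype.val) (f := fun e => X (some e))
      Subtype.val_injective.injOn, himg]
  ext f
  rw [cycleIdeal, RingHom.mem_ker, RingHom.mem_ker, h, AlgHom.comp_apply]
  exact (map_eq_zero_iff _ (rename_injective _ hinj)).symm

/-- The exponent of `z` records the degree: give `z` weight one and every `y_e` weight zero. -/
theorem homogeneousComponent_mem_ker_setHom (M : Matroid α) {f : MvPolynomial M.Cyc 𝕜}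
    (hf : f ∈ RingHom.ker (M.setHom 𝕜)) (n : ℕ) :
    homogeneousComponent n f ∈ RingHom.ker (M.setHom 𝕜) := by
  rw [RingHom.mem_ker] at hf ⊢
  have hw (C : M.Cyc) : IsWeightedHomogeneous (fun o : Option α => if o = none then 1 else 0)
      (setMonomial 𝕜 (C : Set α)) 1 := by
    classical
    rw [setMonomial, show (1 : ℕ) = 0 + 1 by rfl]
    refine IsWeightedHomogeneous.mul ?_ ?_
    · refine finprod_mem_induction (fun p => IsWeightedHomogeneous _ p 0)
        (isWeightedHomogeneous_one _ _) (fun p q hp hq => hp.mul hq) fun e _ => ?_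
      simpa using isWeightedHomogeneous_X 𝕜 (fun o : Option α => if o = none then 1 else 0) (some e)
    · simpa using isWeightedHomogeneous_X 𝕜 (fun o : Option α => if o = none then 1 else 0) none
  rw [setHom, aeval_homogeneousComponent _ hw, ← setHom, hf, map_zero]

/-- The cycle ideal of `M` is generated in degree at most two. -/
def IsQuadratic (𝕜 : Type*) [Field 𝕜] (M : Matroid α) : Prop :=
  IsGeneratedInDegreeLE (RingHom.ker (M.setHom 𝕜)) 2

theorem isQuadratic_of_mu_le_two (M : Matroid α) [M.Finite] (h : M.mu 𝕜 ≤ 2) :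
    M.IsQuadratic 𝕜 := by
  refine IsGeneratedInDegreeLE.of_isMinHomogGenSet
    (fun f hf n => M.homogeneousComponent_mem_ker_setHom hf n) fun G hG f hf => ?_
  rw [← cycleIdeal_eq_ker_setHom] at hG
  simp only [mu, iSup_le_iff] at h
  have h2 : ((f.totalDegree : ℕ∞) : WithBot ℕ∞) ≤ ((2 : ℕ∞) : WithBot ℕ∞) := h G hG f hf
  exact_mod_cast WithBot.coe_le_coe.1 h2

/-! ### Cycles -/

theorem isCycle_empty (M : Matroid α) : M.IsCycle ∅ :=
  ⟨∅, by simp, by simp, by simp⟩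

theorem IsCycle.union_isCircuit {M : Matroid α} {C D : Set α} (hC : M.IsCycle C)
    (hD : M.IsCircuit D) (hCD : Disjoint C D) : M.IsCycle (C ∪ D) := by
  obtain ⟨S, hS, hdj, rfl⟩ := hC
  refine ⟨insert D S, ?_, ?_, by rw [Set.sUnion_insert, Set.union_comm]⟩
  · rintro _ (rfl | h)
    exacts [hD, hS _ h]
  · refine hdj.insert fun B hB _ => ?_
    exact (hCD.mono_left (Set.subset_sUnion_of_mem hB)).symm

theorem IsCircuit.isCycle {M : Matroid α} {D : Set α} (hD : M.IsCircuit D) :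
    M.IsCycle D := by
  simpa using M.isCycle_empty.union_isCircuit hD (Set.empty_disjoint D)

theorem IsCycle.induction {M : Matroid α} [M.Finite] {p : Set α → Prop} {C : Set α}
    (hC : M.IsCycle C) (empty : p ∅)
    (union : ∀ C D, M.IsCycle C → p C → M.IsCircuit D → Disjoint C D → p (C ∪ D)) : p C := by
  obtain ⟨S, hS, hdj, rfl⟩ := hC
  have hfin : S.Finite := M.ground_finite.finite_subsets.subset fun D hD => (hS D hD).subset_ground
  suffices h : M.IsCycle (⋃₀ S) ∧ p (⋃₀ S) from h.2
  induction S, hfin using Set.Finite.induction_on with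
  | empty => simpa using ⟨M.isCycle_empty, empty⟩
  | @insert D S hDS _ ih =>
    obtain ⟨h1, h2⟩ := ih (fun B hB => hS B (Set.mem_insert_of_mem _ hB))
      (hdj.subset (Set.subset_insert _ _))
    have hd : Disjoint (⋃₀ S) D := by
      rw [Set.disjoint_sUnion_left]
      intro B hB
      exact hdj (Set.mem_insert_of_mem _ hB) (Set.mem_insert _ _) (by rintro rfl; exact hDS hB)
    have hD := hS D (Set.mem_insert _ _)
    rw [Set.sUnion_insert, Set.union_comm]
    exact ⟨h1.union_isCircuit hD hd, union _ _ h1 h2 hD hd⟩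

/-! ### Binary matroids -/

/-- Over `𝔽₂` a linear combination is the sum over a subset, so coefficients can be dropped. -/
theorem IsBinary.exists_indep_iff {M : Matroid α} (hM : M.IsBinary) :
    ∃ (m : ℕ) (w : α → Fin m → ZMod 2), ∀ s : Finset α, (s : Set α) ⊆ M.E →
      (M.Indep s ↔ ∀ t ⊆ s, ∑ e ∈ t, w e = 0 → t = ∅) := by
  classical
  obtain ⟨m, A, hA⟩ := hM
  obtain ⟨w, hwA⟩ : ∃ w : α → Fin m → ZMod 2, ∀ e : M.E, w e = A.col e :=
    ⟨fun e => if he : e ∈ M.E then A.col ⟨e, he⟩ else 0, fun e => by simp⟩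
  refine ⟨m, w, fun s hs => ?_⟩
  obtain ⟨s, rfl⟩ : ∃ s' : Finset M.E, s'.map (Function.Embedding.subtype _) = s :=
    ⟨s.subtype _, by ext e; simpa using fun h => hs h⟩
  have h1 := hA s
  rw [linearIndepOn_finset_iff] at h1
  rw [Finset.coe_map]
  refine h1.trans ⟨fun h t ht ht0 => ?_, fun h g hg i hi => ?_⟩
  · obtain ⟨t, hts, rfl⟩ := Finset.subset_map_iff.1 ht
    have h0 := h (fun e => if e ∈ t then 1 else 0) (by
      classical
      rw [Finset.sum_map] at ht0
      simp only [Function.Embedding.coe_subtype, hwA] at ht0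
      simp only [ite_smul, one_smul, zero_smul, ← Finset.sum_filter]
      rwa [Finset.filter_mem_eq_inter, Finset.inter_eq_right.2 hts])
    rw [Finset.map_eq_empty, Finset.eq_empty_iff_forall_notMem]
    intro e he
    simpa [he] using h0 e (hts he)
  · by_contra hne
    have := h ((s.filter (g · ≠ 0)).map (Function.Embedding.subtype _))
      (Finset.map_subset_map.2 (Finset.filter_subset _ _)) (by
        rw [Finset.sum_map]
        simp only [Function.Embedding.coe_subtype, hwA]
        rw [Finset.sum_filter]
        refine Eq.trans ?_ hg
        refine Finset.sum_congr rfl fun e _ => ?_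
        have : ∀ x : ZMod 2, x = 0 ∨ x = 1 := by decide
        rcases this (g e) with h | h <;> simp [h])
    rw [Finset.map_eq_empty, Finset.eq_empty_iff_forall_notMem] at this
    exact this i (by simp [hi, hne])

/-- A circuit contains a nonempty zero-sum set, which is dependent, hence equals the circuit.
Conversely a nonempty zero-sum set is dependent; split off a circuit and induct. -/
theorem IsBinary.exists_isCycle_iff {M : Matroid α} [M.Finite] (hM : M.IsBinary) :
    ∃ (m : ℕ) (w : α → Fin m → ZMod 2), ∀ s : Finset α, (s : Set α) ⊆ M.E →
      (M.IsCycle s ↔ ∑ e ∈ s, w e = 0) := by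
  classical
  obtain ⟨m, w, hw⟩ := hM.exists_indep_iff
  have hcirc (s : Finset α) (hs : M.IsCircuit s) : ∑ e ∈ s, w e = 0 := by
    have := hs.not_indep
    rw [hw s hs.subset_ground] at this
    push Not at this
    obtain ⟨t, hts, ht0, hne⟩ := this
    have htE : (t : Set α) ⊆ M.E := (Finset.coe_subset.2 hts).trans hs.subset_ground
    have ht : ¬ M.Indep t := fun h => hne.ne_empty ((hw t htE).1 h t subset_rfl ht0)
    rwa [← Finset.coe_injective (hs.eq_of_not_indep_subset ht (Finset.coe_subset.2 hts))]
  refine ⟨m, w, fun s hs => ⟨fun h => ?_, fun h => ?_⟩⟩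
  · refine h.induction (p := fun C => ∀ s : Finset α, (s : Set α) = C → ∑ e ∈ s, w e = 0)
      ?_ ?_ s rfl
    · rintro s h
      rw [Finset.coe_eq_empty.1 h, Finset.sum_empty]
    · intro C D hC hpC hD hCD s hs
      lift C to Finset α using hC.finite
      lift D to Finset α using hD.isCycle.finite
      rw [← Finset.coe_union, Finset.coe_inj] at hs
      rw [hs, Finset.sum_union (Finset.disjoint_coe.1 hCD), hpC C rfl, hcirc D hD, add_zero]
  · induction s using Finset.strongInduction with
    | H s ih =>
    by_cases hs0 : s = ∅
    · simpa [hs0] using M.isCycle_empty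
    have hdep : M.Dep s := by
      rw [← not_indep_iff hs, hw s hs]
      exact fun hi => hs0 (hi s subset_rfl h)
    obtain ⟨D, hDs, hD⟩ := hdep.exists_isCircuit_subset
    lift D to Finset α using hD.isCycle.finite
    have hDs' := Finset.coe_subset.1 hDs
    have hsum := Finset.sum_sdiff (f := w) hDs'
    rw [hcirc D hD, add_zero, h] at hsum
    have hlt : s \ D ⊂ s := Finset.sdiff_ssubset hDs' (Finset.coe_nonempty.1 hD.nonempty)
    have := (ih _ hlt ((Finset.coe_subset.2 hlt.1).trans hs) hsum).union_isCircuit hD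
      (by rw [Finset.disjoint_coe]; exact Finset.sdiff_disjoint)
    rwa [← Finset.coe_union, Finset.sdiff_union_of_subset hDs'] at this

theorem IsCycle.symmDiff_isCycle {M : Matroid α} [M.Finite] (hM : M.IsBinary) {C D : Set α}
    (hC : M.IsCycle C) (hD : M.IsCycle D) : M.IsCycle (symmDiff C D) := by
  classical
  obtain ⟨m, w, hw⟩ := hM.exists_isCycle_iff
  have hCE := hC.subset_ground
  have hDE := hD.subset_ground
  lift C to Finset α using hC.finite
  lift D to Finset α using hD.finite
  rw [← Finset.coe_symmDiff]
  rw [hw _ hCE] at hC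
  rw [hw _ hDE] at hD
  have hE : ((symmDiff C D : Finset α) : Set α) ⊆ M.E := by
    rw [Finset.coe_symmDiff]
    exact Set.symmDiff_subset_union.trans (Set.union_subset hCE hDE)
  rw [hw _ hE, symmDiff_def, Finset.sup_eq_union, Finset.sum_union disjoint_sdiff_sdiff]
  have h1 := Finset.sum_inter_add_sum_sdiff C D w
  have h2 := Finset.sum_inter_add_sum_sdiff D C w
  rw [Finset.inter_comm, hD] at h2
  rw [hC] at h1
  have h3 : ∑ e ∈ C ∩ D, w e + ∑ e ∈ C ∩ D, w e = 0 :=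
    funext fun i => CharTwo.add_self_eq_zero _
  rw [eq_neg_of_add_eq_zero_right h1, eq_neg_of_add_eq_zero_right h2, ← neg_add, h3, neg_zero]

/-- Induction on the size of `C \ X`: lift a circuit `D ⊆ C \ X` of `M ／ X` to a circuit `K` of `M`
with `D ⊆ K ⊆ D ∪ X`. Replacing `C` by `symmDiff C K` removes exactly `D` outside `X`. -/
theorem IsCycle.contract_sdiff {M : Matroid α} [M.Finite] (hM : M.IsBinary) {C : Set α}
    (hC : M.IsCycle C) (X : Set α) : (M ／ X).IsCycle (C \ X) := by
  induction hn : (C \ X).ncard using Nat.strong_induction_on generalizing C with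
  | _ n ih =>
  by_cases h0 : C ⊆ X
  · rw [Set.sdiff_eq_empty.2 h0]
    exact isCycle_empty _
  obtain ⟨D, hDC, hD⟩ : ∃ D ⊆ C \ X, (M ／ X).IsCircuit D := by
    obtain ⟨S, hS, -, rfl⟩ := hC
    simp only [Set.sUnion_subset_iff, not_forall] at h0
    obtain ⟨K, hK, hKX⟩ := h0
    obtain ⟨D, hDK, hD⟩ := ((hS K hK).contract_dep_of_not_subset hKX).exists_isCircuit_subset
    exact ⟨D, hDK.trans (Set.sdiff_subset_sdiff_left (Set.subset_sUnion_of_mem hK)), hD⟩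
  obtain ⟨K, hK, hDK, hKD⟩ := hD.exists_subset_isCircuit_of_contract
  have hDX : Disjoint D X := (Set.subset_sdiff.1 hDC).2
  have heq : symmDiff C K \ X = (C \ X) \ D := by
    ext e
    have h1 := @hDC e
    have h2 := @hDK e
    have h3 := @hKD e
    simp only [Set.mem_sdiff, Set.mem_symmDiff, Set.mem_union] at *
    tauto
  have hfin : (C \ X).Finite := hC.finite.sdiff
  have hlt : (symmDiff C K \ X).ncard < n := by
    rw [heq, ← hn]
    refine Set.ncard_lt_ncard (Set.ssubset_iff_subset_ne.2 ⟨Set.sdiff_subset, fun h => ?_⟩) hfin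
    obtain ⟨e, he⟩ := hD.nonempty
    exact (h.symm ▸ hDC he : e ∈ (C \ X) \ D).2 he
  have := (ih _ hlt (hC.symmDiff_isCycle hM hK.isCycle) rfl).union_isCircuit hD
    (by rw [heq]; exact Set.disjoint_sdiff_left)
  rwa [heq, Set.sdiff_union_of_subset hDC] at this

theorem IsCycle.exists_of_contract {M : Matroid α} [M.Finite] (hM : M.IsBinary) {D X : Set α}
    (hD : (M ／ X).IsCycle D) : ∃ C, M.IsCycle C ∧ C \ X = D := by
  refine hD.induction (p := fun D => ∃ C, M.IsCycle C ∧ C \ X = D)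
    ⟨∅, M.isCycle_empty, by simp⟩ ?_
  rintro _ D' - ⟨C, hC, rfl⟩ hD' hdj
  obtain ⟨C', hC', hDC, hCD⟩ := hD'.exists_subset_isCircuit_of_contract
  refine ⟨symmDiff C C', hC.symmDiff_isCycle hM hC'.isCycle, ?_⟩
  ext e
  have h1 := @hDC e
  have h2 := @hCD e
  have h3 := fun h => Set.disjoint_left.1 hdj (show e ∈ _ from h)
  have hE := hD'.subset_ground
  have h4 := @hE e
  simp only [Set.mem_sdiff, Set.mem_symmDiff, Set.mem_union, contract_ground] at *
  tauto

/-! ### Effect of the operations on the cycles -/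

theorem isCycle_delete_iff {M : Matroid α} {X C : Set α} :
    (M ＼ X).IsCycle C ↔ M.IsCycle C ∧ Disjoint C X := by
  constructor
  · rintro ⟨S, hS, hdj, rfl⟩
    refine ⟨⟨S, fun D hD => (hS D hD).of_delete, hdj, rfl⟩, ?_⟩
    rw [Set.disjoint_sUnion_left]
    exact fun D hD => (delete_isCircuit_iff.1 (hS D hD)).2
  · rintro ⟨⟨S, hS, hdj, rfl⟩, hX⟩
    rw [Set.disjoint_sUnion_left] at hX
    exact ⟨S, fun D hD => delete_isCircuit_iff.2 ⟨hS D hD, hX D hD⟩, hdj, rfl⟩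

/-- Orthogonality: a circuit and a cocircuit never meet in exactly one element. -/
theorem IsCircuit.mem_iff_of_isCocircuit_pair {M : Matroid α} {C : Set α} (hC : M.IsCircuit C)
    {e f : α} (hK : M.IsCocircuit {e, f}) : e ∈ C ↔ f ∈ C := by
  have h1 := hC.inter_isCocircuit_ne_singleton hK (e := e)
  have h2 := hC.inter_isCocircuit_ne_singleton hK (e := f)
  constructor
  · intro he
    by_contra hf
    refine h1 ?_
    ext x
    simp only [Set.mem_inter_iff, Set.mem_insert_iff, Set.mem_singleton_iff]
    grind
  · intro hf
    by_contra he
    refine h2 ?_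
    ext x
    simp only [Set.mem_inter_iff, Set.mem_insert_iff, Set.mem_singleton_iff]
    grind

theorem IsCircuit.series_contract {M : Matroid α} {e f : α} (hef : e ≠ f)
    (hK : M.IsCocircuit {e, f}) {D : Set α} (hD : M.IsCircuit D) :
    (M ／ {e}).IsCircuit (D \ {e}) := by
  by_cases he : e ∈ D
  · exact hD.contractElem_isCircuit ⟨e, he, f, (hD.mem_iff_of_isCocircuit_pair hK).1 he, hef⟩ he
  rw [Set.sdiff_singleton_eq_self he]
  obtain ⟨D₁, hD₁, hc⟩ := (hD.contract_dep (C := {e}) (by simpa)).exists_isCircuit_subset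
  obtain ⟨C', hC', h1, h2⟩ := hc.exists_subset_isCircuit_of_contract
  have hf : f ∉ C' := fun hf => by
    have hfD : f ∉ D := fun h => he ((hD.mem_iff_of_isCocircuit_pair hK).2 h)
    rcases h2 hf with h | h
    exacts [hfD (hD₁ h), hef h.symm]
  have he' : e ∉ C' := fun h => hf ((hC'.mem_iff_of_isCocircuit_pair hK).1 h)
  have hsub : C' ⊆ D₁ := fun x hx => (h2 hx).resolve_right fun h => he' (h ▸ hx)
  have heq : D₁ = D :=
    (h1.antisymm hsub).trans (hD.eq_of_superset_isCircuit hC' (hsub.trans hD₁)).symm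
  exact heq ▸ hc

theorem IsCycle.series_contract {M : Matroid α} [M.Finite] {e f : α} (hef : e ≠ f)
    (hK : M.IsCocircuit {e, f}) {C : Set α} (hC : M.IsCycle C) :
    (M ／ {e}).IsCycle (C \ {e}) := by
  refine hC.induction (p := fun C => (M ／ {e}).IsCycle (C \ {e}))
    (by simpa using isCycle_empty _) fun C D _ hpC hD hCD => ?_
  rw [Set.union_sdiff_distrib]
  exact hpC.union_isCircuit (IsCircuit.series_contract hef hK hD)
    (hCD.mono Set.sdiff_subset Set.sdiff_subset)

/-- The series partner `f` decides whether `e` belongs to the lift. The set is written in the shape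
required by `IsQuadratic.of_lift`. -/
theorem IsCycle.of_series_contract {M : Matroid α} [M.Finite] {e f : α} (hef : e ≠ f)
    (hK : M.IsCocircuit {e, f}) {D : Set α} (hD : (M ／ {e}).IsCycle D) :
    M.IsCycle (D ∪ {x ∈ ({e} : Set α) | f ∈ D}) := by
  refine hD.induction (p := fun D => M.IsCycle (D ∪ {x ∈ ({e} : Set α) | f ∈ D}))
    (by simpa using isCycle_empty _) fun D D' hD hpD hD' hDD' => ?_
  obtain ⟨C', hC', h1, h2⟩ := hD'.exists_subset_isCircuit_of_contract
  have hE' : e ∉ D' := fun h => (hD'.subset_ground h).2 rfl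
  have hE : e ∉ D := fun h => (hD.subset_ground h).2 rfl
  have hCef := hC'.mem_iff_of_isCocircuit_pair hK
  have hC'eq : C' = D' ∪ {x ∈ ({e} : Set α) | f ∈ D'} := by
    ext x
    have h1' := @h1 x
    have h2' := @h2 x
    have h1f := @h1 f
    have h2f := @h2 f
    simp only [Set.mem_union, Set.mem_singleton_iff, Set.mem_ofPred_eq] at *
    grind
  have hdj : Disjoint (D ∪ {x ∈ ({e} : Set α) | f ∈ D}) C' := by
    rw [hC'eq, Set.disjoint_left]
    intro x
    have h3 := fun h => Set.disjoint_left.1 hDD' (show x ∈ _ from h)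
    have h4 := fun h => Set.disjoint_left.1 hDD' (show f ∈ _ from h)
    simp only [Set.mem_union, Set.mem_singleton_iff, Set.mem_ofPred_eq] at *
    grind
  convert! hpD.union_isCircuit hC' hdj using 1
  rw [hC'eq]
  ext x
  simp only [Set.mem_union, Set.mem_singleton_iff, Set.mem_ofPred_eq]
  tauto

/-- "Agreeing" and "complementary" behave like even and odd, and add modulo two over disjoint
unions. -/
theorem IsCycle.mem_iff_of_forall_isCircuit {M : Matroid α} [M.Finite] {ι : Type*} {e e' : ι → α}
    (h : ∀ C, M.IsCircuit C → (∀ i, e i ∈ C ↔ e' i ∈ C) ∨ ∀ i, e i ∈ C ↔ e' i ∉ C) {C : Set α}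
    (hC : M.IsCycle C) : (∀ i, e i ∈ C ↔ e' i ∈ C) ∨ ∀ i, e i ∈ C ↔ e' i ∉ C := by
  refine hC.induction (p := fun C => (∀ i, e i ∈ C ↔ e' i ∈ C) ∨ ∀ i, e i ∈ C ↔ e' i ∉ C)
    (by simp) fun C D _ hpC hD hCD => ?_
  rw [Set.disjoint_left] at hCD
  simp only [Set.mem_union]
  rcases hpC with h1 | h1 <;> rcases h D hD with h2 | h2
  · exact Or.inl fun i => by have := h1 i; have := h2 i; tauto
  · exact Or.inr fun i => by
      have := h1 i; have := h2 i; have := @hCD (e i); have := @hCD (e' i); tauto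
  · exact Or.inr fun i => by
      have := h1 i; have := h2 i; have := @hCD (e i); have := @hCD (e' i); tauto
  · exact Or.inl fun i => by
      have := h1 i; have := h2 i; have := @hCD (e i); have := @hCD (e' i); tauto

/-! ### Quadratic generation under the operations -/

theorem setMonomial_coe (s : Finset α) :
    setMonomial 𝕜 (s : Set α) = (∏ e ∈ s, X (some e)) * X none := by
  rw [setMonomial, finprod_mem_coe_finset]

theorem IsQuadratic.delete {M : Matroid α} [M.Finite] (h : M.IsQuadratic 𝕜) (D : Set α) :
    (M ＼ D).IsQuadratic 𝕜 := by
  classical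
  -- On the target side the retraction sets `y_e = 0` for `e ∈ D`.
  refine IsGeneratedInDegreeLE.of_retract (φ := M.setHom 𝕜)
    (fun C : (M ＼ D).Cyc => (⟨C, (isCycle_delete_iff.1 C.2).1⟩ : M.Cyc))
    (fun C : M.Cyc => if hC : Disjoint (C : Set α) D then
      X ⟨C, isCycle_delete_iff.2 ⟨C.2, hC⟩⟩ else 0)
    (fun C => ?_) (fun C => ?_) (AlgHom.id 𝕜 _)
    (aeval fun o => o.elim (X none) fun e => if e ∈ D then 0 else X (some e))
    (fun C => ?_) (fun C => ?_) h
  · split_ifs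
    exacts [isHomogeneous_X _ _, isHomogeneous_zero _ _ _]
  · simp [(isCycle_delete_iff.1 C.2).2]
  · simp [setHom]
  · obtain ⟨C, hC⟩ := C
    lift C to Finset α using hC.finite
    simp only [setHom, aeval_X, setMonomial_coe, map_mul, map_prod, Option.elim]
    split_ifs with hd
    · simp only [aeval_X, setMonomial_coe]
      congr 1
      exact Finset.prod_congr rfl fun e he => by
        rw [if_neg (Set.disjoint_left.1 hd he)]
    · obtain ⟨e, heC, heD⟩ := Set.not_disjoint_iff.1 hd
      rw [map_zero, Finset.prod_eq_zero heC (by rw [if_pos heD]), zero_mul]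

/-- If removing `X` maps cycles of `M` to cycles of `N`, and every cycle of `N` lifts to a cycle
of `M` in which each `x ∈ X` is present iff `g x` is, then quadratic generation passes from `M` to
`N`. -/
theorem IsQuadratic.of_lift {M N : Matroid α} [M.Finite] [N.Finite] (h : M.IsQuadratic 𝕜)
    {Y : Set α} (hY : Y.Finite) (g : α → α) (hN : Disjoint N.E Y)
    (hMN : ∀ C, M.IsCycle C → N.IsCycle (C \ Y))
    (hNM : ∀ D, N.IsCycle D → M.IsCycle (D ∪ {x ∈ Y | g x ∈ D})) :
    N.IsQuadratic 𝕜 := by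
  classical
  lift Y to Finset α using hY
  -- On the target side, `y_e` is lifted to `y_e` times all `y_x` with `x ∈ Y` and `g x = e`, and
  -- the retraction sets `y_x = 1` for `x ∈ Y`.
  refine IsGeneratedInDegreeLE.of_retract (φ := M.setHom 𝕜)
    (fun D : N.Cyc => (⟨_, hNM D D.2⟩ : M.Cyc)) (fun C : M.Cyc => X ⟨_, hMN C C.2⟩)
    (fun C => isHomogeneous_X _ _) (fun D => ?_)
    (aeval fun o => o.elim (X none) fun e => X (some e) * ∏ x ∈ Y with g x = e, X (some x))
    (aeval fun o => o.elim (X none) fun e => if e ∈ Y then 1 else X (some e))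
    (fun D => ?_) (fun C => ?_) h
  · congr 2
    have := hN.mono_left D.2.subset_ground
    ext x
    have h1 := fun h => Set.disjoint_left.1 this (show x ∈ _ from h)
    simp only [Set.mem_sdiff, Set.mem_union, Set.mem_ofPred_eq]
    tauto
  · obtain ⟨D, hD⟩ := D
    have hdj := hN.mono_left hD.subset_ground
    lift D to Finset α using hD.finite
    have heq : (D : Set α) ∪ {x ∈ (Y : Set α) | g x ∈ (D : Set α)} =
        ((D ∪ {x ∈ Y | g x ∈ D} : Finset α) : Set α) := by
      ext x; simp
    simp only [setHom, aeval_X, heq, setMonomial_coe, map_mul, map_prod, Option.elim]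
    congr 1
    rw [Finset.prod_union, Finset.prod_mul_distrib]
    · congr 1
      rw [← Finset.prod_fiberwise_of_maps_to (t := D) (g := g) (by simp)]
      refine Finset.prod_congr rfl fun e he => Finset.prod_congr ?_ fun _ _ => rfl
      ext x
      simp only [Finset.mem_filter]
      exact ⟨fun h => ⟨h.1.1, h.2⟩, fun h => ⟨⟨h.1, h.2 ▸ he⟩, h.2⟩⟩
    · exact (Finset.disjoint_coe.1 hdj).mono_right (Finset.filter_subset _ _)
  · obtain ⟨C, hC⟩ := C
    lift C to Finset α using hC.finite
    simp only [setHom, aeval_X, ← Finset.coe_sdiff, setMonomial_coe, map_mul, map_prod, Option.elim]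
    congr 1
    rw [← Finset.filter_notMem_eq_sdiff, Finset.prod_filter]
    refine Finset.prod_congr rfl fun e _ => ?_
    split_ifs <;> simp_all

theorem IsQuadratic.seriesStep {M N : Matroid α} [M.Finite] (h : M.IsQuadratic 𝕜)
    (hN : M.SeriesStep N) : N.IsQuadratic 𝕜 := by
  cases hN with
  | deletion e he => exact h.delete _
  | seriesContraction e K hK hcard he =>
    obtain ⟨f, hef, rfl⟩ : ∃ f, e ≠ f ∧ K = {e, f} := by
      obtain ⟨a, b, hab, rfl⟩ := Set.ncard_eq_two.1 hcard
      rcases he with rfl | rfl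
      exacts [⟨b, hab, rfl⟩, ⟨a, hab.symm, Set.pair_comm _ _⟩]
    refine h.of_lift (Set.finite_singleton e) (fun _ => f) ?_
      (fun C hC => hC.series_contract hef hK) (fun D hD => hD.of_series_contract hef hK)
    exact Set.disjoint_sdiff_left
  | coloopContraction e he =>
    rw [contract_eq_delete_of_subset_coloops (Set.singleton_subset_iff.2 he)]
    exact h.delete _

theorem IsQuadratic.retract {M N : Matroid α} [M.Finite] (h : M.IsQuadratic 𝕜)
    (hN : N.IsBinaryMatroidalRetract M) : N.IsQuadratic 𝕜 := by
  obtain ⟨hM, s, e, e', -, he, he', hdj, -, hE', hC, rfl⟩ := hN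
  have hmem {C : Set α} {e : Fin s → α} (he : e.Injective) {J : Set (Fin s)}
      (h : C ∩ Set.range e = e '' J) (i : Fin s) : e i ∈ C ↔ i ∈ J := by
    rw [← he.mem_set_image (s := J), ← h]
    simp
  have hcirc (C : Set α) (hCc : M.IsCircuit C) :
      (∀ i, e i ∈ C ↔ e' i ∈ C) ∨ ∀ i, e i ∈ C ↔ e' i ∉ C := by
    -- The retract condition says nothing for the full index set. In that case `C` contains the
    -- circuit `E'`, hence equals it and misses `E`: the complementary alternative.
    by_cases hJ : {i | e' i ∈ C} = Set.univ
    · have hsub : Set.range e' ⊆ C := by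
        rintro _ ⟨i, rfl⟩
        exact hJ.ge (Set.mem_univ i)
      obtain rfl := hE'.eq_of_subset_isCircuit hCc hsub
      refine Or.inr fun i => ?_
      simp [fun h => Set.disjoint_left.1 hdj (Set.mem_range_self i) h]
    · have h1 := (hC C hCc _ hJ).1 (by
        ext x
        constructor
        · rintro ⟨hx, i, rfl⟩
          exact ⟨i, hx, rfl⟩
        · rintro ⟨i, hi, rfl⟩
          exact ⟨hi, i, rfl⟩)
      exact h1.imp (fun h1 i => hmem he h1 i) (fun h1 i => hmem he h1 i)
  refine h.of_lift (Set.finite_range e') (Function.extend e' e id) Set.disjoint_sdiff_left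
    (fun C hC => hC.contract_sdiff hM _) fun D hD => ?_
  have key (C : Set α) (hCc : M.IsCycle C) (hCe : ∀ i, e i ∈ C ↔ e' i ∈ C)
      (hCD : C \ Set.range e' = D) :
      M.IsCycle (D ∪ {x ∈ Set.range e' | Function.extend e' e id x ∈ D}) := by
    convert! hCc using 1
    subst hCD
    have hnot (i : Fin s) : e i ∉ Set.range e' := Set.disjoint_left.1 hdj (Set.mem_range_self i)
    ext x
    by_cases hx : x ∈ Set.range e'
    · obtain ⟨i, rfl⟩ := hx
      have h1 := hnot i
      have h2 := hCe i
      simp only [Set.mem_union, Set.mem_sdiff, Set.mem_ofPred_eq, he'.extend_apply,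
        Set.mem_range_self]
      tauto
    · simp only [Set.mem_union, Set.mem_sdiff, Set.mem_ofPred_eq]
      tauto
  obtain ⟨C, hCc, hCD⟩ := hD.exists_of_contract hM
  rcases hCc.mem_iff_of_forall_isCircuit hcirc with h1 | h1
  · exact key C hCc h1 hCD
  -- Adding the circuit `E'` turns a complementary cycle into an agreeing one without changing it
  -- outside `E'`.
  · refine key _ (hCc.symmDiff_isCycle hM hE'.isCycle) (fun i => ?_) ?_
    · have h2 := h1 i
      have h3 : e i ∉ Set.range e' := Set.disjoint_left.1 hdj (Set.mem_range_self i)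
      have h4 : e' i ∈ Set.range e' := Set.mem_range_self i
      simp only [Set.mem_symmDiff]
      tauto
    · rw [← hCD]
      ext x
      simp only [Set.mem_symmDiff, Set.mem_sdiff]
      tauto

/-! ### Sequences of operations -/

theorem IsGSeriesMinor.isQuadratic {M N : Matroid α} [M.Finite] (hN : N.IsGSeriesMinor M)
    (h : M.IsQuadratic 𝕜) : N.IsQuadratic 𝕜 := by
  suffices h : N.Finite ∧ N.IsQuadratic 𝕜 from h.2
  induction hN with
  | refl => exact ⟨inferInstance, h⟩
  | tail _ hstep ih =>
    obtain ⟨hfin, hq⟩ := ih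
    cases hstep with
    | series hs =>
      refine ⟨?_, hq.seriesStep hs⟩
      cases hs <;> infer_instance
    | retract hr =>
      refine ⟨?_, hq.retract hr⟩
      obtain ⟨-, s, e, e', -, -, -, -, -, -, -, rfl⟩ := hr
      infer_instance

theorem IsGSeriesMinor.isMinor {M N : Matroid α} (hN : N.IsGSeriesMinor M) : N ≤m M := by
  induction hN with
  | refl => exact IsMinor.refl
  | tail _ hstep ih =>
    refine IsMinor.trans ?_ ih
    cases hstep with
    | series hs =>
      cases hs <;> first | exact ⟨∅, _, by rw [contract_empty]⟩ | exact ⟨_, ∅, (delete_empty _).symm⟩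
    | retract hr =>
      obtain ⟨-, s, e, e', -, -, -, -, -, -, -, rfl⟩ := hr
      exact ⟨_, ∅, (delete_empty _).symm⟩

theorem IsSeriesColoopMinor.isGSeriesMinor {M N : Matroid α} (hN : N.IsSeriesColoopMinor M) :
    N.IsGSeriesMinor M :=
  Relation.ReflTransGen.mono (fun _ N h => GSeriesStep.series N h) _ _ hN

/-! ### Invariance under isomorphism -/

theorem IsCycle.image {M : Matroid α} {N : Matroid β} {g : α → β} (hg : Set.BijOn g M.E N.E)
    (hind : ∀ I ⊆ M.E, M.Indep I ↔ N.Indep (g '' I)) {C : Set α} (hC : M.IsCycle C) :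
    N.IsCycle (g '' C) := by
  obtain ⟨S, hS, hdj, rfl⟩ := hC
  have hSE (D) (hD : D ∈ S) : D ⊆ M.E := (hS D hD).subset_ground
  refine ⟨Set.image g '' S, ?_, ?_, ?_⟩
  · rintro _ ⟨D, hD, rfl⟩
    rw [isCircuit_iff_forall_ssubset, dep_iff, ← hind D (hSE D hD)]
    refine ⟨⟨(hS D hD).not_indep, (Set.image_mono (hSE D hD)).trans hg.image_eq.le⟩, fun I hI => ?_⟩
    obtain ⟨J, hJ, rfl⟩ := Set.subset_image_iff.1 hI.1
    rw [← hind J (hJ.trans (hSE D hD))]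
    refine (hS D hD).ssubset_indep (hJ.ssubset_of_ne ?_)
    rintro rfl
    exact hI.ne rfl
  · rintro _ ⟨D, hD, rfl⟩ _ ⟨D', hD', rfl⟩ hne
    have := hdj hD hD' (by rintro rfl; exact hne rfl)
    refine Set.disjoint_left.2 ?_
    rintro _ ⟨x, hx, rfl⟩ ⟨y, hy, hxy⟩
    exact Set.disjoint_left.1 this hx (hg.injOn (hSE D' hD' hy) (hSE D hD hx) hxy ▸ hy)
  · rw [Set.sUnion_image, Set.sUnion_eq_biUnion, Set.image_iUnion₂]

theorem IsCycle.setMonomial_image {M : Matroid α} [M.Finite] {g : α → β} (hg : Set.InjOn g M.E)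
    {C : Set α} (hC : M.IsCycle C) :
    setMonomial 𝕜 (g '' C) = rename (Option.map g) (setMonomial 𝕜 C) := by
  classical
  have hC' := hC.subset_ground
  lift C to Finset α using hC.finite
  rw [← Finset.coe_image, setMonomial_coe, setMonomial_coe, Finset.prod_image (hg.mono hC')]
  simp [map_prod]

theorem IsQuadratic.of_bijOn [Nonempty α] {M : Matroid α} {N : Matroid β} [M.Finite]
    [N.Finite] {g : α → β}
    (hg : Set.BijOn g M.E N.E) (hind : ∀ I ⊆ M.E, M.Indep I ↔ N.Indep (g '' I))
    (h : M.IsQuadratic 𝕜) : N.IsQuadratic 𝕜 := by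
  set g' := Function.invFunOn g M.E with hg'
  have hinv : Set.InvOn g' g M.E N.E := hg.invOn_invFunOn
  have hbij : Set.BijOn g' N.E M.E := hinv.symm.bijOn hg.surjOn.mapsTo_invFunOn hg.mapsTo
  have himg {D : Set β} (hD : D ⊆ N.E) : g '' (g' '' D) = D := hinv.2.mono hD |>.image_image
  have himg' {C : Set α} (hC : C ⊆ M.E) : g' '' (g '' C) = C := hinv.1.mono hC |>.image_image
  have hind' (I) (hI : I ⊆ N.E) : N.Indep I ↔ M.Indep (g' '' I) := by
    rw [hind _ ((Set.image_mono hI).trans hbij.image_eq.le), himg hI]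
  refine IsGeneratedInDegreeLE.of_retract (φ := M.setHom 𝕜)
    (fun D : N.Cyc => (⟨g' '' D, D.2.image hbij hind'⟩ : M.Cyc))
    (fun C : M.Cyc => X ⟨g '' C, C.2.image hg hind⟩)
    (fun C => isHomogeneous_X _ _) (fun D => ?_)
    (rename (Option.map g')) (rename (Option.map g)) (fun D => ?_) (fun C => ?_) h
  · congr 2
    exact himg D.2.subset_ground
  · simp only [setHom, aeval_X]
    exact D.2.setMonomial_image hbij.injOn
  · simp only [setHom, aeval_X]
    exact C.2.setMonomial_image hg.injOn

theorem IsQuadratic.of_isIsomorphic [Nonempty α] [Nonempty β] {M : Matroid α} {N : Matroid β}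
    [M.Finite] [N.Finite] (hMN : M.IsIsomorphic N) (h : M.IsQuadratic 𝕜) : N.IsQuadratic 𝕜 := by
  classical
  obtain ⟨φ, hφ⟩ := hMN
  obtain ⟨b⟩ := ‹Nonempty β›
  set g : α → β := fun a => if ha : a ∈ M.E then φ ⟨a, ha⟩ else b with hg
  have hgφ (a : M.E) : g a = φ a := by simp [hg]
  refine h.of_bijOn (g := g) ⟨fun a ha => ?_, fun a ha a' ha' haa => ?_, fun b hb => ?_⟩
    fun I hI => ?_
  · exact hgφ ⟨a, ha⟩ ▸ (φ _).2
  · rw [hgφ ⟨a, ha⟩, hgφ ⟨a', ha'⟩, Subtype.val_inj, φ.apply_eq_iff_eq] at haa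
    exact congrArg Subtype.val haa
  · exact ⟨φ.symm ⟨b, hb⟩, (φ.symm ⟨b, hb⟩).2, by rw [hgφ, φ.apply_symm_apply]⟩
  · have hsub : g '' I ⊆ N.E := by
      rintro _ ⟨a, ha, rfl⟩
      exact hgφ ⟨a, hI ha⟩ ▸ (φ _).2
    rw [← hφ, mapSetEquiv_indep_iff, and_iff_left hsub]
    congr! 1
    ext a
    constructor
    · intro ha
      exact ⟨⟨a, hI ha⟩, ⟨φ ⟨a, hI ha⟩, ⟨a, ha, hgφ ⟨a, hI ha⟩⟩, by simp⟩, rfl⟩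
    · rintro ⟨x, ⟨y, ⟨a', ha', h'⟩, rfl⟩, rfl⟩
      have : φ ⟨a', hI ha'⟩ = y := Subtype.ext ((hgφ ⟨a', hI ha'⟩).symm.trans h')
      rw [← this, φ.symm_apply_apply]
      exact ha'

end Matroid

/-! ### Even edge sets and explicit short cycles in graphs -/

namespace SimpleGraph

variable {V : Type*}

/-- Every vertex lies on an even number of the edges in `s`. -/
def IsEvenEdgeSet [DecidableEq V] (s : Finset (Sym2 V)) : Prop :=
  ∀ v : V, Even {e ∈ s | v ∈ e}.card

instance [DecidableEq V] [Fintype V] : DecidablePred (IsEvenEdgeSet (V := V)) :=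
  fun s => inferInstanceAs (Decidable (∀ v : V, Even {e ∈ s | v ∈ e}.card))

theorem IsEvenEdgeSet.union [DecidableEq V] {s t : Finset (Sym2 V)} (hs : IsEvenEdgeSet s)
    (ht : IsEvenEdgeSet t) (hst : Disjoint s t) : IsEvenEdgeSet (s ∪ t) := by
  intro v
  rw [Finset.filter_union, Finset.card_union_of_disjoint (Finset.disjoint_filter_filter hst)]
  exact (hs v).add (ht v)

/-- Take the edges of a cycle. That they are again not acyclic makes them fill any circuit of the
cycle matroid containing them. -/
theorem exists_isEvenEdgeSet_of_not_isAcyclic [DecidableEq V] {I : Set (Sym2 V)}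
    (h : ¬ (fromEdgeSet I).IsAcyclic) :
    ∃ t : Finset (Sym2 V), (t : Set (Sym2 V)) ⊆ I ∧ t.Nonempty ∧ IsEvenEdgeSet t ∧
      ¬ (fromEdgeSet (t : Set (Sym2 V))).IsAcyclic := by
  simp only [IsAcyclic, not_forall, not_not] at h
  obtain ⟨v, c, hc⟩ := h
  have hI : ∀ e ∈ c.edges, e ∈ I ∧ ¬ e.IsDiag := fun e he => by
    simpa using c.edges_subset_edgeSet he
  refine ⟨c.edges.toFinset, fun e he => (hI e (by simpa using he)).1, ?_, fun x => ?_, ?_⟩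
  · rw [List.toFinset_nonempty_iff]
    intro h0
    exact hc.ne_nil (Walk.edges_eq_nil.1 h0).eq_nil
  · have := (hc.isTrail.even_countP_edges_iff x).2 (fun h => absurd rfl h)
    rw [List.countP_eq_length_filter] at this
    rwa [← List.toFinset_card_of_nodup (hc.isTrail.edges_nodup.filter _),
      List.toFinset_filter, Finset.filter_congr (q := fun e => x ∈ e) (by simp)] at this
  · intro hac
    refine hac _ (hc.transfer (H := fromEdgeSet (c.edges.toFinset : Set (Sym2 V))) fun e he => ?_)
    simpa using ⟨he, (hI e he).2⟩

theorem not_isAcyclic_of_triangle {s : Set (Sym2 V)} {a b c : V} (hab : a ≠ b) (hbc : b ≠ c)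
    (hca : c ≠ a) (h1 : s(a, b) ∈ s) (h2 : s(b, c) ∈ s) (h3 : s(c, a) ∈ s) :
    ¬ (fromEdgeSet s).IsAcyclic := by
  intro hac
  have e1 : (fromEdgeSet s).Adj a b := by simp [*]
  have e2 : (fromEdgeSet s).Adj b c := by simp [*]
  have e3 : (fromEdgeSet s).Adj c a := by simp [*]
  refine hac (.cons e1 (.cons e2 (.cons e3 .nil))) ?_
  simp [Walk.isCycle_def, Walk.isTrail_def, hab, hbc, hca, hab.symm, hca.symm]

theorem not_isAcyclic_of_quadrangle {s : Set (Sym2 V)} {a b c d : V} (hab : a ≠ b) (hac : a ≠ c)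
    (had : a ≠ d) (hbc : b ≠ c) (hbd : b ≠ d) (hcd : c ≠ d)
    (h1 : s(a, b) ∈ s) (h2 : s(b, c) ∈ s) (h3 : s(c, d) ∈ s) (h4 : s(d, a) ∈ s) :
    ¬ (fromEdgeSet s).IsAcyclic := by
  intro h
  have e1 : (fromEdgeSet s).Adj a b := by simp [*]
  have e2 : (fromEdgeSet s).Adj b c := by simp [*]
  have e3 : (fromEdgeSet s).Adj c d := by simp [*]
  have e4 : (fromEdgeSet s).Adj d a := by simp [*, had.symm]
  refine h (.cons e1 (.cons e2 (.cons e3 (.cons e4 .nil)))) ?_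
  simp [Walk.isCycle_def, Walk.isTrail_def, hab, hbc, hcd, had, hac, hbd, hab.symm,
    had.symm, hac.symm]

end SimpleGraph

/-! ### The cycles of `M(K₄)` -/

namespace Matroid
open SimpleGraph MvPolynomial

instance : MK4.Finite := ⟨Set.toFinite _⟩

theorem MK4_ground : MK4.E = (⊤ : SimpleGraph (Fin 4)).edgeSet := rfl

theorem MK4_indep_iff {I : Set (Sym2 (Fin 4))} :
    MK4.Indep I ↔ I ⊆ (⊤ : SimpleGraph (Fin 4)).edgeSet ∧ (fromEdgeSet I).IsAcyclic := by
  rw [MK4, cycleMatroid]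
  rfl

/-- The cycles of `M(K₄)`: the empty set, the four triangles and the three quadrangles. -/
def cyclesK4 : Fin 8 → Finset (Sym2 (Fin 4)) :=
  ![∅, {s(0, 1), s(1, 2), s(2, 0)}, {s(0, 1), s(1, 3), s(3, 0)}, {s(0, 2), s(2, 3), s(3, 0)},
    {s(1, 2), s(2, 3), s(3, 1)}, {s(0, 1), s(1, 2), s(2, 3), s(3, 0)},
    {s(0, 1), s(1, 3), s(3, 2), s(2, 0)}, {s(0, 2), s(2, 1), s(1, 3), s(3, 0)}]

theorem cyclesK4_injective : Function.Injective cyclesK4 := by decide +kernel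

theorem mem_range_cyclesK4 : ∀ s ∈ (⊤ : SimpleGraph (Fin 4)).edgeFinset.powerset,
    IsEvenEdgeSet s → ∃ i, cyclesK4 i = s := by decide +kernel

theorem cyclesK4_minimal : ∀ i, ∀ t ∈ (cyclesK4 i).powerset,
    IsEvenEdgeSet t → t = ∅ ∨ t = cyclesK4 i := by decide +kernel

theorem cyclesK4_subset : ∀ i, cyclesK4 i ⊆ (⊤ : SimpleGraph (Fin 4)).edgeFinset := by
  decide +kernel

theorem cyclesK4_coe_subset (i : Fin 8) : (cyclesK4 i : Set (Sym2 (Fin 4))) ⊆ MK4.E := by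
  rw [MK4_ground, ← coe_edgeFinset]
  exact Finset.coe_subset.2 (cyclesK4_subset i)

theorem not_isAcyclic_cyclesK4 (i : Fin 8) (hi : i ≠ 0) :
    ¬ (fromEdgeSet (cyclesK4 i : Set (Sym2 (Fin 4)))).IsAcyclic := by
  fin_cases i
  · exact absurd rfl hi
  · refine not_isAcyclic_of_triangle (a := 0) (b := 1) (c := 2) ?_ ?_ ?_ ?_ ?_ ?_ <;>
      simp [cyclesK4]
  · refine not_isAcyclic_of_triangle (a := 0) (b := 1) (c := 3) ?_ ?_ ?_ ?_ ?_ ?_ <;>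
      simp [cyclesK4]
  · refine not_isAcyclic_of_triangle (a := 0) (b := 2) (c := 3) ?_ ?_ ?_ ?_ ?_ ?_ <;>
      simp [cyclesK4]
  · refine not_isAcyclic_of_triangle (a := 1) (b := 2) (c := 3) ?_ ?_ ?_ ?_ ?_ ?_ <;>
      simp [cyclesK4]
  · refine not_isAcyclic_of_quadrangle (a := 0) (b := 1) (c := 2) (d := 3)
      ?_ ?_ ?_ ?_ ?_ ?_ ?_ ?_ ?_ ?_ <;> simp [cyclesK4]
  · refine not_isAcyclic_of_quadrangle (a := 0) (b := 1) (c := 3) (d := 2)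
      ?_ ?_ ?_ ?_ ?_ ?_ ?_ ?_ ?_ ?_ <;> simp [cyclesK4]
  · refine not_isAcyclic_of_quadrangle (a := 0) (b := 2) (c := 1) (d := 3)
      ?_ ?_ ?_ ?_ ?_ ?_ ?_ ?_ ?_ ?_ <;> simp [cyclesK4]

theorem isCycle_cyclesK4 (i : Fin 8) : MK4.IsCycle (cyclesK4 i : Set (Sym2 (Fin 4))) := by
  by_cases hi : i = 0
  · subst hi
    simpa [cyclesK4] using MK4.isCycle_empty
  refine IsCircuit.isCycle (isCircuit_iff_forall_ssubset.2 ⟨⟨fun h => ?_, cyclesK4_coe_subset i⟩,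
    fun I hI => ?_⟩)
  · exact not_isAcyclic_cyclesK4 i hi (MK4_indep_iff.1 h).2
  · refine MK4_indep_iff.2 ⟨hI.1.trans (cyclesK4_coe_subset i), ?_⟩
    by_contra hac
    obtain ⟨t, htI, hne, hev, -⟩ := exists_isEvenEdgeSet_of_not_isAcyclic hac
    rcases cyclesK4_minimal i t (Finset.mem_powerset.2 (Finset.coe_subset.1 (htI.trans hI.1))) hev
      with h | h
    · exact hne.ne_empty h
    · exact hI.2 (h ▸ htI)

theorem isEvenEdgeSet_of_isCycle_MK4 {C : Set (Sym2 (Fin 4))} (hC : MK4.IsCycle C) :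
    ∃ s : Finset (Sym2 (Fin 4)), (s : Set _) = C ∧ IsEvenEdgeSet s := by
  refine hC.induction (p := fun C => ∃ s : Finset (Sym2 (Fin 4)), (s : Set _) = C ∧ IsEvenEdgeSet s)
    ⟨∅, by simp, fun v => by simp⟩ ?_
  rintro _ D - ⟨s, rfl, hs⟩ hD hsD
  have hdep : ¬ (fromEdgeSet D).IsAcyclic := fun h =>
    hD.not_indep (MK4_indep_iff.2 ⟨hD.subset_ground, h⟩)
  obtain ⟨t, htD, -, hev, hac⟩ := exists_isEvenEdgeSet_of_not_isAcyclic hdep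
  have := hD.eq_of_not_indep_subset (X := t) (fun h => hac (MK4_indep_iff.1 h).2) htD
  subst this
  exact ⟨s ∪ t, by simp, hs.union hev (Finset.disjoint_coe.1 hsD)⟩

/-- The enumeration of the cycles of `M(K₄)`. -/
def cycEquivK4 : Fin 8 ≃ MK4.Cyc :=
  Equiv.ofBijective (fun i => ⟨cyclesK4 i, isCycle_cyclesK4 i⟩) (by
    refine ⟨fun i j hij => cyclesK4_injective ?_, fun ⟨C, hC⟩ => ?_⟩
    · exact Finset.coe_injective (congrArg Subtype.val hij)
    · obtain ⟨s, rfl, hs⟩ := isEvenEdgeSet_of_isCycle_MK4 hC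
      have hE := hC.subset_ground
      rw [MK4_ground, ← coe_edgeFinset] at hE
      obtain ⟨i, rfl⟩ := mem_range_cyclesK4 s
        (Finset.mem_powerset.2 (Finset.coe_subset.1 hE)) hs
      exact ⟨i, rfl⟩)

theorem cycEquivK4_coe (i : Fin 8) : (cycEquivK4 i : Set (Sym2 (Fin 4))) = cyclesK4 i := rfl

/-! ### The cycle ideal of `M(K₄)` -/

variable {α 𝕜 : Type*} [Field 𝕜]

theorem setMonomial_eq_monomial (s : Finset α) :
    setMonomial 𝕜 (s : Set α) =
      monomial (∑ e ∈ s, Finsupp.single (some e) 1 + Finsupp.single none 1) 1 := by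
  rw [setMonomial_coe, ← mul_one (1 : 𝕜), ← monomial_mul, monomial_sum_one]
  rfl

/-- The exponent vector of the image under `setHom` of a monomial in the variables `x_C`. -/
def cycExponent (M : Matroid α) [M.Finite] (m : M.Cyc →₀ ℕ) : Option α →₀ ℕ :=
  m.sum fun C k => k • (∑ e ∈ C.2.finite.toFinset, Finsupp.single (some e) 1 +
    Finsupp.single none 1)

theorem setHom_monomial (M : Matroid α) [M.Finite] (m : M.Cyc →₀ ℕ) (a : 𝕜) :
    M.setHom 𝕜 (monomial m a) = monomial (M.cycExponent m) a := by
  have h (C : M.Cyc) : setMonomial 𝕜 (C : Set α) = monomial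
      (∑ e ∈ C.2.finite.toFinset, Finsupp.single (some e) 1 + Finsupp.single none 1) 1 := by
    rw [← setMonomial_eq_monomial, Set.Finite.coe_toFinset]
  rw [setHom, aeval_monomial, algebraMap_eq]
  simp only [h, monomial_pow, one_pow, cycExponent, Finsupp.prod, Finsupp.sum]
  rw [← monomial_sum_one, C_mul_monomial, mul_one]

/-- An element of the kernel of `setHom` vanishes if its monomials have distinct images. -/
theorem eq_zero_of_mem_ker_setHom (M : Matroid α) [M.Finite] {f : MvPolynomial M.Cyc 𝕜}
    (hf : f ∈ RingHom.ker (M.setHom 𝕜)) (hinj : Set.InjOn M.cycExponent f.support) : f = 0 := by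
  classical
  rw [RingHom.mem_ker] at hf
  have h1 : ∑ m ∈ f.support, monomial (M.cycExponent m) (coeff m f) = 0 := by
    rw [← hf]
    conv_rhs => rw [← support_sum_monomial_coeff f]
    rw [map_sum]
    exact Finset.sum_congr rfl fun m _ => (setHom_monomial M m _).symm
  ext m
  rw [coeff_zero]
  by_contra hm
  have hm' := mem_support_iff.2 hm
  have h2 := congrArg (coeff (M.cycExponent m)) h1
  rw [coeff_sum, Finset.sum_eq_single m, coeff_monomial, if_pos rfl, coeff_zero] at h2
  · exact hm h2
  · intro m' hm'' hne
    rw [coeff_monomial, if_neg fun h => hne (hinj hm'' hm' h)]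
  · exact fun h => absurd hm' h

theorem cycExponent_MK4_some (m : MK4.Cyc →₀ ℕ) (e : Sym2 (Fin 4)) :
    MK4.cycExponent m (some e) = ∑ i, if e ∈ cyclesK4 i then m (cycEquivK4 i) else 0 := by
  classical
  have : Fintype MK4.Cyc := Fintype.ofFinite _
  rw [cycExponent, Finsupp.sum_fintype _ _ (by simp), ← cycEquivK4.sum_comp,
    Finsupp.finsetSum_apply]
  refine Finset.sum_congr rfl fun i _ => ?_
  simp [Finsupp.single_apply, cycEquivK4_coe]
  exact if_congr Iff.rfl rfl rfl

/-- The degree and the six edge multiplicities leave a rank-one lattice of differences, generated by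
the exponent difference of `quarticK4`. A nonzero multiple forces degree at least four. -/
theorem cycExponent_MK4_injOn {n : ℕ} (hn : n ≤ 3) :
    Set.InjOn MK4.cycExponent {m | m.degree = n} := by
  intro m hm m' hm' h
  have : Fintype MK4.Cyc := Fintype.ofFinite _
  have hd (m : MK4.Cyc →₀ ℕ) : m.degree = ∑ i, m (cycEquivK4 i) := by
    rw [Finsupp.degree_eq_sum, cycEquivK4.sum_comp]
  have h0 : ∑ i, m (cycEquivK4 i) = n := hd m ▸ hm
  have h0' : ∑ i, m' (cycEquivK4 i) = n := hd m' ▸ hm'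
  have he (e : Sym2 (Fin 4)) := DFunLike.congr_fun h (some e)
  simp only [cycExponent_MK4_some] at he
  have h1 := he s(0, 1)
  have h2 := he s(0, 2)
  have h3 := he s(0, 3)
  have h4 := he s(1, 2)
  have h5 := he s(1, 3)
  have h6 := he s(2, 3)
  simp only [Fin.sum_univ_eight] at h0 h0' h1 h2 h3 h4 h5 h6
  simp [cyclesK4] at h1 h2 h3 h4 h5 h6
  suffices ∀ i, m (cycEquivK4 i) = m' (cycEquivK4 i) by
    ext C
    obtain ⟨i, rfl⟩ := cycEquivK4.surjective C
    exact this i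
  intro i
  fin_cases i <;> simp only [Fin.zero_eta, Fin.mk_one, Fin.reduceFinMk] <;> omega

/-- The quartic binomial in the cycle ideal of `M(K₄)`. -/
def quarticK4 (𝕜 : Type*) [Field 𝕜] : MvPolynomial MK4.Cyc 𝕜 :=
  X (cycEquivK4 0) * X (cycEquivK4 5) * X (cycEquivK4 6) * X (cycEquivK4 7) -
    X (cycEquivK4 1) * X (cycEquivK4 2) * X (cycEquivK4 3) * X (cycEquivK4 4)

theorem quarticK4_ne_zero : quarticK4 𝕜 ≠ 0 := by
  intro h
  -- Setting `x_∅ = 0` and all other variables to one gives the value `-1`.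
  have := congrArg (aeval fun C => if C = cycEquivK4 0 then (0 : 𝕜) else 1) h
  simp [quarticK4] at this

theorem quarticK4_mem : quarticK4 𝕜 ∈ RingHom.ker (MK4.setHom 𝕜) := by
  rw [RingHom.mem_ker]
  simp only [quarticK4, setHom, map_sub, map_mul, aeval_X, cycEquivK4_coe, setMonomial_coe]
  simp [cyclesK4]
  rw [Sym2.eq_swap (a := (3 : Fin 4)) (b := 0), Sym2.eq_swap (a := (3 : Fin 4)) (b := 1),
    Sym2.eq_swap (a := (3 : Fin 4)) (b := 2), Sym2.eq_swap (a := (2 : Fin 4)) (b := 0),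
    Sym2.eq_swap (a := (2 : Fin 4)) (b := 1)]
  ring

theorem not_isQuadratic_MK4 : ¬ MK4.IsQuadratic 𝕜 := by
  intro h
  have h1 := h quarticK4_mem
  have h2 : {f | f ∈ RingHom.ker (MK4.setHom 𝕜) ∧ ∃ n ≤ 2, f.IsHomogeneous n} ⊆ {0} := by
    rintro f ⟨hf, n, hn, hfn⟩
    refine eq_zero_of_mem_ker_setHom MK4 hf ((cycExponent_MK4_injOn (n := n) (by omega)).mono ?_)
    intro m hm
    have := hfn (mem_support_iff.1 hm)
    exact (DFunLike.congr_fun (Finsupp.degree_eq_weight_one (R := ℕ)) m).trans this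
  have h3 := Ideal.span_mono h2 h1
  exact quarticK4_ne_zero (by simpa using h3)

end Matroid

end

theorem mainTheorem10 {α : Type*} (M : Matroid α) [M.Finite] (hM : M.IsBinary)
    (𝕜 : Type*) [Field 𝕜] :
    (M.mu 𝕜 ≤ 2 → M.GSeriesMinorFree Matroid.MK4) ∧
    (M.MinorFree Matroid.MK4 → M.GSeriesMinorFree Matroid.MK4) ∧
    (M.GSeriesMinorFree Matroid.MK4 → M.SeriesColoopMinorFree Matroid.MK4) := by
  refine ⟨fun h N hN hiso => ?_, fun h N hN => h N hN.isMinor,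
    fun h N hN => h N hN.isGSeriesMinor⟩
  have hfin : N.Finite := ⟨M.ground_finite.subset hN.isMinor.subset⟩
  -- Transport along the isomorphism extends its inverse to all of `Sym2 (Fin 4)`, which needs a
  -- default value in `α`; an edge of `K₄` supplies one.
  have hne : Nonempty α := by
    obtain ⟨φ, -⟩ := hiso
    exact ⟨φ.symm ⟨s(0, 1), by simp [Matroid.MK4_ground]⟩⟩
  exact Matroid.not_isQuadratic_MK4
    ((hN.isQuadratic (M.isQuadratic_of_mu_le_two h)).of_isIsomorphic hiso)
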